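/- A 2-tree is a (finite, simple) graph defined recursively: a complete graph on $2$ vertices is a 2-tree, and so is any graph obtained from a 2-tree by adjoining a new vertex together with two edges joining it to the two endpoints of an existing edge. Let $T$ be a 2-tree with automorphism group $\operatorname{Aut}(T)$. A directed triangle of $T$ is a cyclic orientation $a\to b\to c\to a$ of a triangle of $T$; it is a symmetry triangle if its three directed edges $(a,b),(b,c),(c,a)$ all lie in the same orbit of $\operatorname{Aut}(T)$ acting on directed edges, and a nonsymmetry triangle otherwise. Two edges (respectively, two nonsymmetry triangles) of $T$ are similar if some automorphism of $T$ takes one to the other (respectively, takes one, with its orientation, to the other). **Lemma.** For every 2-tree $T$, the number of similarity classes of edges of $T$ is one more than the number of similarity classes of nonsymmetry triangles of $T$. -/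

import Mathlib

universe u

/-- `k`-trees: a complete graph on `k` vertices is a `k`-tree, and so is every graph obtained from a
`k`-tree by adjoining a new vertex `w` together with `k` edges connecting it to a `k`-clique.
In the second clause the smaller `k`-tree is `G - w`; the neighbours of `w` are then
automatically vertices of `G - w`. -/
inductive IsKTree (k : ℕ) : {V : Type u} → SimpleGraph V → Prop
  | complete {V : Type u} (hfin : Finite V) (hcard : Nat.card V = k) :
      IsKTree k (⊤ : SimpleGraph V)
  | adjoin {V : Type u} (G : SimpleGraph V) (w : V)
      (hsmall : IsKTree k (G.induce ({w}ᶜ : Set V)))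
      (hclique : G.IsClique (G.neighborSet w))
      (hcard : (G.neighborSet w).encard = k) :
      IsKTree k G

namespace SimpleGraph

variable {V : Type u} (G : SimpleGraph V)

/-- Two edges are similar if some automorphism of the graph takes one to the other. -/
def edgeSimilarity : Setoid G.edgeSet where
  r e f := ∃ φ : G ≃g G, φ.mapEdgeSet e = f
  iseqv :=
    { refl := fun e => ⟨RelIso.refl _, Subtype.ext (by simp [Iso.mapEdgeSet, Hom.mapEdgeSet])⟩
      symm := by
        rintro e f ⟨φ, rfl⟩
        exact ⟨φ.symm, φ.mapEdgeSet.symm_apply_apply e⟩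
      trans := by
        rintro e f g ⟨φ, rfl⟩ ⟨ψ, rfl⟩
        refine ⟨φ.trans ψ, ?_⟩
        obtain ⟨e, he⟩ := e
        induction e with
        | _ a b => rfl }

/-- Two directed edges (darts) are in the same orbit of the automorphism group. -/
def DartSimilar (d d' : G.Dart) : Prop :=
  ∃ φ : G ≃g G, φ.toHom.mapDart d = d'

/-- A directed triangle, i.e. a cyclic orientation `a → b → c → a` of a triangle, given by the set
of its three directed edges. -/
structure DirectedTriangle where
  darts : Set G.Dart
  exists_eq : ∃ (a b c : V) (hab : G.Adj a b) (hbc : G.Adj b c) (hca : G.Adj c a),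
    darts = {⟨(a, b), hab⟩, ⟨(b, c), hbc⟩, ⟨(c, a), hca⟩}

variable {G}

/-- A symmetry triangle is a directed triangle whose directed edges are all in the same orbit
under the automorphism group. -/
def DirectedTriangle.IsSymmetry (t : G.DirectedTriangle) : Prop :=
  ∀ d ∈ t.darts, ∀ d' ∈ t.darts, G.DartSimilar d d'

variable (G)

/-- A nonsymmetry triangle is a directed triangle that is not a symmetry triangle. -/
def NonsymmetryTriangle : Type u :=
  {t : G.DirectedTriangle // ¬ t.IsSymmetry}

/-- Two nonsymmetry triangles are similar if some automorphism of the graph takes one (with its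
orientation) to the other. -/
def nonsymmetryTriangleSimilarity : Setoid G.NonsymmetryTriangle where
  r t t' := ∃ φ : G ≃g G, φ.toHom.mapDart '' t.1.darts = t'.1.darts
  iseqv :=
    { refl := fun t => ⟨RelIso.refl _, Set.image_id t.1.darts⟩
      symm := by
        rintro t t' ⟨φ, h⟩
        refine ⟨φ.symm, ?_⟩
        rw [← h, Set.image_image]
        convert Set.image_id t.1.darts using 2
        ext <;> simp [Hom.mapDart]
      trans := by
        rintro t t' t'' ⟨φ, h⟩ ⟨ψ, h'⟩
        refine ⟨φ.trans ψ, ?_⟩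
        rw [← h', ← h, Set.image_image]
        rfl }

end SimpleGraph

/-! Peel the 2-tree in layers, always counting classes under the full group Aut(G), so that deleting
vertices never changes what similar means. The induction runs over Aut(G)-invariant sets `S` that
induce 2-trees. Let `D` be the set of degree-two vertices of `S`. If no two of them are adjacent,
all of `D` can be deleted at once (`TwoTreeOn.diff_degreeTwoOn`), and what remains is again an
invariant 2-tree. Each lost edge joins some `w` in `D` to some `a` outside `D` and lies in a single
triangle of `S`. Sending it to `w → a → b → w` matches the lost edge classes with the lost triangle
classes (`TwoTreeOn.ncard_classesOn_step`), so the difference of the two counts is unchanged. The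
peeling ends at an edge, where 1 = 0 + 1, or at two adjacent degree-two vertices, which force `S` to
be a triangle (`IsAutInvariant.ncard_classesOn_triangle`). -/

namespace SimpleGraph

variable {V : Type u} {G : SimpleGraph V}

/-! ### 2-trees as vertex subsets of a fixed graph -/

/-- The vertex set `S` induces a 2-tree in `G`. -/
inductive TwoTreeOn (G : SimpleGraph V) : Set V → Prop
  | pair {a b : V} (hab : G.Adj a b) : TwoTreeOn G {a, b}
  | adjoin {S : Set V} {w a b : V} (hS : TwoTreeOn G S) (hw : w ∉ S) (hab : G.Adj a b)
      (hN : ∀ x, x ∈ S ∧ G.Adj w x ↔ x = a ∨ x = b) : TwoTreeOn G (insert w S)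

/-- The vertex `v` of `S` has exactly two neighbours in `S`. -/
def DegreeTwoOn (G : SimpleGraph V) (S : Set V) (v : V) : Prop :=
  v ∈ S ∧ ∃ a b, a ≠ b ∧ ∀ x, x ∈ S ∧ G.Adj v x ↔ x = a ∨ x = b

/-- The recursion in `IsKTree` changes the vertex type; this carries the smaller tree back into the
ambient graph. -/
theorem TwoTreeOn.map {W : Type u} {H : SimpleGraph W} (f : H ↪g G) {S : Set W}
    (h : TwoTreeOn H S) : TwoTreeOn G (f '' S) := by
  induction h with
  | pair hab =>
    rw [Set.image_pair]
    exact .pair (f.map_adj_iff.2 hab)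
  | @adjoin S w a b hS hw hab hN ih =>
    rw [Set.image_insert_eq]
    refine .adjoin (a := f a) (b := f b) ih ?_ (f.map_adj_iff.2 hab) ?_
    · rintro ⟨x, hx, hxw⟩
      exact hw (f.injective hxw ▸ hx)
    · intro x
      constructor
      · rintro ⟨⟨y, hy, rfl⟩, hwy⟩
        rw [f.map_adj_iff] at hwy
        simpa using (hN y).1 ⟨hy, hwy⟩
      · rintro (rfl | rfl)
        · have := (hN a).2 (.inl rfl)
          exact ⟨⟨a, this.1, rfl⟩, f.map_adj_iff.2 this.2⟩
        · have := (hN b).2 (.inr rfl)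
          exact ⟨⟨b, this.1, rfl⟩, f.map_adj_iff.2 this.2⟩

theorem TwoTreeOn.finite {S : Set V} (h : TwoTreeOn G S) : S.Finite := by
  induction h with
  | pair => exact Set.toFinite _
  | adjoin _ _ _ _ ih => exact ih.insert _

theorem _root_.IsKTree.twoTreeOn_univ {k : ℕ} (hG : IsKTree k G) (hk : k = 2) :
    TwoTreeOn G Set.univ := by
  induction hG with
  | @complete V hfin hcard =>
    obtain ⟨a, b, hab, h⟩ := Nat.card_eq_two_iff.1 (hcard.trans hk)
    rw [← h]
    exact .pair hab
  | @adjoin V G w hsmall hclique hcard ih =>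
    subst hk
    obtain ⟨a, b, hab, h⟩ := Set.encard_eq_two.1 hcard
    have h1 := ih.map (Embedding.induce ({w}ᶜ : Set V))
    have h2 : (Embedding.induce (G := G) ({w}ᶜ : Set V)) '' Set.univ = {w}ᶜ := by
      ext x
      simp [Embedding.induce]
    rw [h2] at h1
    have h3 : insert w ({w}ᶜ : Set V) = Set.univ := by
      ext x
      simp [em]
    rw [← h3]
    refine .adjoin (a := a) (b := b) h1 (by simp) (hclique (by simp [h]) (by simp [h]) hab) ?_
    intro x
    have hx : G.Adj w x ↔ x = a ∨ x = b := by
      rw [← mem_neighborSet, h]; rfl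
    rw [← hx]
    exact ⟨fun h => h.2, fun h => ⟨h.ne', h⟩⟩

/-- A newly adjoined vertex has two neighbours. An older vertex with only one lies, by induction, in
a single edge, and the next vertex is then joined to both of its ends. -/
theorem TwoTreeOn.eq_pair_of_unique_neighbor {S : Set V} (h : TwoTreeOn G S) {c d : V}
    (hc : c ∈ S) (hd : ∀ x ∈ S, G.Adj c x → x = d) : S = {c, d} := by
  induction h with
  | @pair a b hab =>
    rcases hc with rfl | rfl
    · rw [hd b (by simp) hab]
    · rw [hd a (by simp) hab.symm, Set.pair_comm]
  | @adjoin S w a b hS hw hab hN ih =>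
    have ha := (hN a).2 (.inl rfl)
    have hb := (hN b).2 (.inr rfl)
    rcases hc with rfl | hc
    · exact absurd ((hd a (.inr ha.1) ha.2).trans (hd b (.inr hb.1) hb.2).symm) hab.ne
    · have hS' := ih hc fun x hx => hd x (.inr hx)
      subst hS'
      have hcw : G.Adj w c := by
        rcases ha.1 with rfl | rfl
        · exact ha.2
        · rcases hb.1 with rfl | rfl
          · exact hb.2
          · exact absurd rfl hab.ne
      exact absurd (.inr (hd w (.inl rfl) hcw.symm)) hw

/-- Any degree-two vertex can serve as the last one adjoined. If `v` is not adjacent to the actual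
last vertex `w`, the two adjunctions commute. -/
theorem TwoTreeOn.remove {S : Set V} (h : TwoTreeOn G S) {v a b : V} (hv : v ∈ S) (hab : a ≠ b)
    (hN : ∀ x, x ∈ S ∧ G.Adj v x ↔ x = a ∨ x = b) :
    TwoTreeOn G (S \ {v}) ∧ G.Adj a b := by
  induction h with
  | @pair c d hcd =>
    have ha := (hN a).2 (.inl rfl)
    have hb := (hN b).2 (.inr rfl)
    exfalso
    have := ha.2.ne
    have := hb.2.ne
    grind
  | @adjoin S w c d hS hw hcd hcdN ih =>
    have ha := (hN a).2 (.inl rfl)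
    have hb := (hN b).2 (.inr rfl)
    have hc := (hcdN c).2 (.inl rfl)
    have hd := (hcdN d).2 (.inr rfl)
    rcases hv with rfl | hv
    · rw [Set.insert_sdiff_self_of_notMem hw]
      have hc' := (hN c).1 ⟨.inr hc.1, hc.2⟩
      have hd' := (hN d).1 ⟨.inr hd.1, hd.2⟩
      have := hcd.ne
      refine ⟨hS, ?_⟩
      rcases hc' with rfl | rfl <;> rcases hd' with rfl | rfl
      · exact absurd rfl this
      · exact hcd
      · exact hcd.symm
      · exact absurd rfl this
    · have hvw : v ≠ w := fun h => hw (h ▸ hv)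
      by_cases hadj : G.Adj v w
      -- When `v` and `w` are adjacent, `v` has a single neighbour left in `S`, so `S` is an edge
      -- and the whole tree is a triangle.
      · have key : ∀ c d, c = v → (∀ x, x ∈ S ∧ G.Adj w x ↔ x = c ∨ x = d) → G.Adj c d →
            TwoTreeOn G (insert w S \ {v}) ∧ G.Adj a b := by
          rintro c d rfl hcdN hcd
          have hd := (hcdN d).2 (.inr rfl)
          have hd' := (hN d).1 ⟨.inr hd.1, hcd⟩
          have hw' := (hN w).1 ⟨.inl rfl, hadj⟩
          have hdw : d ≠ w := fun h => hw (h ▸ hd.1)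
          have hS2 : S = {c, d} := by
            refine hS.eq_pair_of_unique_neighbor hv fun x hx hcx => ?_
            have hxw : x ≠ w := fun h => hw (h ▸ hx)
            have := (hN x).1 ⟨.inr hx, hcx⟩
            grind
          have h1 : insert w S \ {c} = {w, d} := by
            subst hS2
            have := hcd.ne
            ext x
            simp only [Set.mem_sdiff, Set.mem_insert_iff, Set.mem_singleton_iff]
            grind
          rw [h1]
          refine ⟨.pair hd.2, ?_⟩
          rcases hd' with rfl | rfl <;> rcases hw' with rfl | rfl
          · exact absurd rfl hdw
          · exact hd.2.symm
          · exact hd.2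
          · exact absurd rfl hdw
        rcases (hcdN v).1 ⟨hv, hadj.symm⟩ with h | h
        · exact key c d h.symm hcdN hcd
        · exact key d c h.symm (fun x => (hcdN x).trans or_comm) hcd.symm
      · have hN' : ∀ x, x ∈ S ∧ G.Adj v x ↔ x = a ∨ x = b := by
          intro x
          rw [← hN x]
          constructor
          · rintro ⟨h1, h2⟩
            exact ⟨.inr h1, h2⟩
          · rintro ⟨rfl | h1, h2⟩
            · exact absurd h2 hadj
            · exact ⟨h1, h2⟩
        obtain ⟨h1, h2⟩ := ih hv hN'
        refine ⟨?_, h2⟩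
        rw [Set.insert_sdiff_of_notMem _ (by simpa using hvw.symm)]
        refine .adjoin (a := c) (b := d) h1 (fun h => hw h.1) hcd fun x => ?_
        rw [← hcdN x]
        constructor
        · rintro ⟨⟨h3, -⟩, h4⟩
          exact ⟨h3, h4⟩
        · rintro ⟨h3, h4⟩
          refine ⟨⟨h3, ?_⟩, h4⟩
          rintro rfl
          exact hadj h4.symm

theorem TwoTreeOn.eq_pair_or_exists_degreeTwoOn {S : Set V} (h : TwoTreeOn G S) :
    (∃ a b, G.Adj a b ∧ S = {a, b}) ∨ ∃ v, DegreeTwoOn G S v := by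
  cases h with
  | @pair a b hab => exact .inl ⟨a, b, hab, rfl⟩
  | @adjoin S w a b hS hw hab hN =>
    refine .inr ⟨w, .inl rfl, a, b, hab.ne, fun x => ?_⟩
    rw [← hN x]
    constructor
    · rintro ⟨rfl | h1, h2⟩
      · exact absurd rfl h2.ne
      · exact ⟨h1, h2⟩
    · rintro ⟨h1, h2⟩
      exact ⟨.inr h1, h2⟩

/-- Removing `v` leaves `u` with one neighbour, so what remains is an edge. -/
theorem TwoTreeOn.eq_triangle_of_adj_degreeTwoOn {S : Set V} (h : TwoTreeOn G S) {u v : V}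
    (hu : DegreeTwoOn G S u) (hv : DegreeTwoOn G S v) (huv : G.Adj u v) :
    ∃ x, G.Adj v x ∧ G.Adj x u ∧ S = {u, v, x} := by
  have key : ∃ x, u ≠ x ∧ ∀ y, y ∈ S ∧ G.Adj v y ↔ y = u ∨ y = x := by
    obtain ⟨-, a, b, hab, hN⟩ := hv
    rcases (hN u).1 ⟨hu.1, huv.symm⟩ with rfl | rfl
    · exact ⟨b, hab, hN⟩
    · exact ⟨a, hab.symm, fun y => (hN y).trans or_comm⟩
  obtain ⟨x, hux, hN⟩ := key
  obtain ⟨hS, hadj⟩ := h.remove hv.1 hux hN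
  have hx := (hN x).2 (.inr rfl)
  refine ⟨x, hx.2, hadj.symm, ?_⟩
  have h1 : S \ {v} = {u, x} := by
    refine hS.eq_pair_of_unique_neighbor ⟨hu.1, huv.ne⟩ ?_
    rintro y ⟨hy, hyv⟩ huy
    obtain ⟨-, a, b, hab, hN'⟩ := hu
    have := (hN' v).1 ⟨hv.1, huv⟩
    have := (hN' x).1 ⟨hx.1, hadj⟩
    have := (hN' y).1 ⟨hy, huy⟩
    have := hx.2.ne
    have : y ≠ v := hyv
    grind
  rw [Set.insert_comm, ← h1, Set.insert_sdiff_singleton, Set.insert_eq_of_mem hv.1]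

theorem TwoTreeOn.diff_degreeTwoOn {S : Set V} (h : TwoTreeOn G S)
    (hind : ∀ u v, DegreeTwoOn G S u → DegreeTwoOn G S v → ¬ G.Adj u v) :
    TwoTreeOn G (S \ {v | DegreeTwoOn G S v}) := by
  have key : ∀ D : Set V, D.Finite → D ⊆ {v | DegreeTwoOn G S v} → TwoTreeOn G (S \ D) := by
    intro D hD
    induction D, hD using Set.Finite.induction_on with
    | empty => simpa using h
    | @insert v D hvD _ ih =>
      intro hsub
      have hv : DegreeTwoOn G S v := hsub (.inl rfl)
      obtain ⟨hvS, a, b, hab, hN⟩ := hv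
      have h1 := ih fun x hx => hsub (.inr hx)
      have h2 : S \ insert v D = (S \ D) \ {v} := by
        ext x
        simp only [Set.mem_sdiff, Set.mem_insert_iff, Set.mem_singleton_iff]
        tauto
      rw [h2]
      refine (h1.remove ⟨hvS, hvD⟩ hab fun x => ?_).1
      rw [← hN x]
      constructor
      · rintro ⟨h3, h4⟩
        exact ⟨h3.1, h4⟩
      · rintro ⟨h3, h4⟩
        -- Independence ensures that the earlier deletions have left both neighbours of `v` in
        -- place.
        exact ⟨⟨h3, fun h5 => hind v x ⟨hvS, a, b, hab, hN⟩ (hsub (.inr h5)) h4⟩, h4⟩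
  exact key _ (h.finite.subset fun v hv => hv.1) subset_rfl

/-! ### Invariant sets of vertices -/

/-- `S` is stable under all automorphisms of `G`. -/
def IsAutInvariant (G : SimpleGraph V) (S : Set V) : Prop :=
  ∀ (φ : G ≃g G) (x : V), x ∈ S → φ x ∈ S

theorem IsAutInvariant.apply_mem_iff {S : Set V} (h : IsAutInvariant G S) (φ : G ≃g G) {x : V} :
    φ x ∈ S ↔ x ∈ S :=
  ⟨fun hx => by simpa using h φ.symm _ hx, h φ x⟩

theorem IsAutInvariant.degreeTwoOn {S : Set V} (h : IsAutInvariant G S) :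
    IsAutInvariant G {v | DegreeTwoOn G S v} := by
  rintro φ v ⟨hv, a, b, hab, hN⟩
  refine ⟨h φ v hv, φ a, φ b, φ.injective.ne hab, fun x => ?_⟩
  obtain ⟨x, rfl⟩ := φ.surjective x
  rw [h.apply_mem_iff, φ.map_adj_iff, hN, φ.injective.eq_iff, φ.injective.eq_iff]

theorem IsAutInvariant.diff {S T : Set V} (hS : IsAutInvariant G S) (hT : IsAutInvariant G T) :
    IsAutInvariant G (S \ T) :=
  fun φ _ hx => ⟨hS φ _ hx.1, fun h => hx.2 ((hT.apply_mem_iff φ).1 h)⟩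

/-! ### Similarity classes in terms of vertices -/

theorem dartSimilar_iff {a b c d : V} {hab : G.Adj a b} {hcd : G.Adj c d} :
    G.DartSimilar ⟨(a, b), hab⟩ ⟨(c, d), hcd⟩ ↔ ∃ φ : G ≃g G, φ a = c ∧ φ b = d := by
  refine exists_congr fun φ => ?_
  rw [Dart.ext_iff]
  exact Prod.mk_inj

theorem DartSimilar.refl (d : G.Dart) : G.DartSimilar d d := ⟨RelIso.refl _, rfl⟩

theorem DartSimilar.symm {d e : G.Dart} (h : G.DartSimilar d e) : G.DartSimilar e d := by
  obtain ⟨φ, rfl⟩ := h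
  refine dartSimilar_iff.2 ⟨φ.symm, ?_, ?_⟩ <;> simp

theorem DartSimilar.trans {d e f : G.Dart} (h : G.DartSimilar d e) (h' : G.DartSimilar e f) :
    G.DartSimilar d f := by
  obtain ⟨φ, rfl⟩ := h
  obtain ⟨ψ, rfl⟩ := h'
  exact ⟨φ.trans ψ, rfl⟩

/-- The similarity class of the edge `ab`. -/
def edgeClass {a b : V} (h : G.Adj a b) : Quotient G.edgeSimilarity :=
  Quotient.mk _ ⟨s(a, b), h⟩

theorem edgeClass_eq_iff {a b c d : V} {hab : G.Adj a b} {hcd : G.Adj c d} :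
    edgeClass hab = edgeClass hcd ↔
      ∃ φ : G ≃g G, (φ a = c ∧ φ b = d) ∨ (φ a = d ∧ φ b = c) := by
  refine Quotient.eq.trans (exists_congr fun φ => ?_)
  rw [Subtype.ext_iff]
  exact Sym2.eq_iff

theorem edgeClass_comm {a b : V} (hab : G.Adj a b) : edgeClass hab = edgeClass hab.symm :=
  edgeClass_eq_iff.2 ⟨RelIso.refl _, .inr ⟨rfl, rfl⟩⟩

/-- The directed triangle `a → b → c → a`. -/
def directedTriangle {a b c : V} (hab : G.Adj a b) (hbc : G.Adj b c) (hca : G.Adj c a) :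
    G.DirectedTriangle :=
  ⟨{⟨(a, b), hab⟩, ⟨(b, c), hbc⟩, ⟨(c, a), hca⟩}, a, b, c, hab, hbc, hca, rfl⟩

theorem DirectedTriangle.ext {s t : G.DirectedTriangle} (h : s.darts = t.darts) : s = t := by
  cases s; cases t; cases h; rfl

theorem DirectedTriangle.exists_eq_directedTriangle (t : G.DirectedTriangle) :
    ∃ (a b c : V) (hab : G.Adj a b) (hbc : G.Adj b c) (hca : G.Adj c a),
      t = directedTriangle hab hbc hca := by
  obtain ⟨a, b, c, hab, hbc, hca, h⟩ := t.exists_eq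
  exact ⟨a, b, c, hab, hbc, hca, DirectedTriangle.ext h⟩

theorem directedTriangle_rotate {a b c : V} (hab : G.Adj a b) (hbc : G.Adj b c)
    (hca : G.Adj c a) : directedTriangle hab hbc hca = directedTriangle hbc hca hab := by
  refine DirectedTriangle.ext (Set.ext fun d => ?_)
  simp only [directedTriangle, Set.mem_insert_iff, Set.mem_singleton_iff]
  tauto

theorem directedTriangle_eq_iff {a b c x y z : V} {hab : G.Adj a b} {hbc : G.Adj b c}
    {hca : G.Adj c a} {hxy : G.Adj x y} {hyz : G.Adj y z} {hzx : G.Adj z x} :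
    directedTriangle hab hbc hca = directedTriangle hxy hyz hzx ↔
      (a = x ∧ b = y ∧ c = z) ∨ (a = y ∧ b = z ∧ c = x) ∨ (a = z ∧ b = x ∧ c = y) := by
  constructor
  · intro h
    have h := congrArg DirectedTriangle.darts h
    have h1 : (⟨(a, b), hab⟩ : G.Dart) ∈ (directedTriangle hxy hyz hzx).darts := by
      rw [← h]; exact .inl rfl
    have h2 : (⟨(b, c), hbc⟩ : G.Dart) ∈ (directedTriangle hxy hyz hzx).darts := by
      rw [← h]; exact .inr (.inl rfl)
    simp only [directedTriangle, Set.mem_insert_iff, Set.mem_singleton_iff, Dart.ext_iff,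
      Prod.mk_inj] at h1 h2
    have := hxy.ne
    have := hyz.ne
    have := hzx.ne
    grind
  · rintro (⟨rfl, rfl, rfl⟩ | ⟨rfl, rfl, rfl⟩ | ⟨rfl, rfl, rfl⟩)
    · rfl
    · rw [directedTriangle_rotate, directedTriangle_rotate]
    · rw [directedTriangle_rotate]

theorem directedTriangle_isSymmetry_iff {a b c : V} {hab : G.Adj a b} {hbc : G.Adj b c}
    {hca : G.Adj c a} : (directedTriangle hab hbc hca).IsSymmetry ↔
      (∃ φ : G ≃g G, φ a = b ∧ φ b = c) ∧ ∃ φ : G ≃g G, φ b = c ∧ φ c = a := by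
  rw [← dartSimilar_iff (hab := hab) (hcd := hbc), ← dartSimilar_iff (hab := hbc) (hcd := hca)]
  constructor
  · intro h
    exact ⟨h _ (.inl rfl) _ (.inr (.inl rfl)), h _ (.inr (.inl rfl)) _ (.inr (.inr rfl))⟩
  · rintro ⟨h1, h2⟩
    have key : ∀ d ∈ (directedTriangle hab hbc hca).darts, G.DartSimilar ⟨(b, c), hbc⟩ d := by
      rintro d (rfl | rfl | rfl)
      · exact h1.symm
      · exact .refl _
      · exact h2
    exact fun d hd d' hd' => (key d hd).symm.trans (key d' hd')

/-- The similarity class of a nonsymmetry triangle `a → b → c → a`. -/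
def triangleClass {a b c : V} (hab : G.Adj a b) (hbc : G.Adj b c) (hca : G.Adj c a)
    (h : ¬ (directedTriangle hab hbc hca).IsSymmetry) :
    Quotient G.nonsymmetryTriangleSimilarity :=
  Quotient.mk _ ⟨directedTriangle hab hbc hca, h⟩

theorem triangleClass_rotate {a b c : V} (hab : G.Adj a b) (hbc : G.Adj b c) (hca : G.Adj c a)
    (h : ¬ (directedTriangle hab hbc hca).IsSymmetry) :
    triangleClass hab hbc hca h =
      triangleClass hbc hca hab (directedTriangle_rotate hab hbc hca ▸ h) :=
  congrArg (Quotient.mk _) (Subtype.ext (directedTriangle_rotate hab hbc hca))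

theorem triangleClass_eq_iff {a b c x y z : V} {hab : G.Adj a b} {hbc : G.Adj b c}
    {hca : G.Adj c a} {hxy : G.Adj x y} {hyz : G.Adj y z} {hzx : G.Adj z x}
    {h : ¬ (directedTriangle hab hbc hca).IsSymmetry}
    {h' : ¬ (directedTriangle hxy hyz hzx).IsSymmetry} :
    triangleClass hab hbc hca h = triangleClass hxy hyz hzx h' ↔
      ∃ φ : G ≃g G, (φ a = x ∧ φ b = y ∧ φ c = z) ∨ (φ a = y ∧ φ b = z ∧ φ c = x) ∨
        (φ a = z ∧ φ b = x ∧ φ c = y) := by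
  refine Quotient.eq.trans (exists_congr fun φ => ?_)
  rw [← directedTriangle_eq_iff (hab := φ.map_adj_iff.2 hab) (hbc := φ.map_adj_iff.2 hbc)
    (hca := φ.map_adj_iff.2 hca) (hxy := hxy) (hyz := hyz) (hzx := hzx)]
  have h1 : φ.toHom.mapDart '' (directedTriangle hab hbc hca).darts =
      (directedTriangle (φ.map_adj_iff.2 hab) (φ.map_adj_iff.2 hbc) (φ.map_adj_iff.2 hca)).darts := by
    simp only [directedTriangle, Set.image_insert_eq, Set.image_singleton]
    rfl
  constructor
  · intro h2
    exact DirectedTriangle.ext (h1.symm.trans h2)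
  · intro h2
    exact h1.trans (congrArg DirectedTriangle.darts h2)

/-- The similarity classes of the edges inside `S`. -/
def edgeClassesOn (G : SimpleGraph V) (S : Set V) : Set (Quotient G.edgeSimilarity) :=
  {q | ∃ (a b : V) (hab : G.Adj a b), a ∈ S ∧ b ∈ S ∧ edgeClass hab = q}

/-- The similarity classes of the nonsymmetry triangles inside `S`. -/
def triangleClassesOn (G : SimpleGraph V) (S : Set V) :
    Set (Quotient G.nonsymmetryTriangleSimilarity) :=
  {q | ∃ (a b c : V) (hab : G.Adj a b) (hbc : G.Adj b c) (hca : G.Adj c a)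
    (h : ¬ (directedTriangle hab hbc hca).IsSymmetry),
    a ∈ S ∧ b ∈ S ∧ c ∈ S ∧ triangleClass hab hbc hca h = q}

theorem edgeClassesOn_univ : edgeClassesOn G Set.univ = Set.univ := by
  refine Set.eq_univ_of_forall fun q => ?_
  induction q using Quotient.inductionOn with
  | _ e =>
    obtain ⟨e, he⟩ := e
    induction e with
    | _ a b => exact ⟨a, b, he, trivial, trivial, rfl⟩

theorem triangleClassesOn_univ : triangleClassesOn G Set.univ = Set.univ := by
  refine Set.eq_univ_of_forall fun q => ?_
  induction q using Quotient.inductionOn with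
  | _ t =>
    obtain ⟨t, ht⟩ := t
    obtain ⟨a, b, c, hab, hbc, hca, rfl⟩ := t.exists_eq_directedTriangle
    exact ⟨a, b, c, hab, hbc, hca, ht, trivial, trivial, trivial, rfl⟩

instance [Finite V] : Finite (Quotient G.nonsymmetryTriangleSimilarity) := by
  have : Finite G.Dart := Finite.of_injective _ (Dart.toProd_injective (G := G))
  have : Finite G.DirectedTriangle :=
    Finite.of_injective DirectedTriangle.darts fun _ _ => DirectedTriangle.ext
  have : Finite G.NonsymmetryTriangle := Subtype.finite
  infer_instance

/-! ### Terminal cases: an edge and a triangle -/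

theorem ncard_classesOn_pair {a b : V} (hab : G.Adj a b) :
    (edgeClassesOn G {a, b}).ncard = (triangleClassesOn G {a, b}).ncard + 1 := by
  have h1 : edgeClassesOn G {a, b} = {edgeClass hab} := by
    ext q
    constructor
    · rintro ⟨x, y, hxy, rfl | rfl, rfl | rfl, rfl⟩
      · exact absurd rfl hxy.ne
      · rfl
      · exact edgeClass_comm _
      · exact absurd rfl hxy.ne
    · rintro rfl
      exact ⟨a, b, hab, .inl rfl, .inr rfl, rfl⟩
  have h2 : triangleClassesOn G {a, b} = ∅ := by
    refine Set.eq_empty_of_forall_notMem ?_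
    rintro q ⟨x, y, z, hxy, hyz, hzx, -, hx, hy, hz, -⟩
    have := hxy.ne
    have := hyz.ne
    have := hzx.ne
    simp only [Set.mem_insert_iff, Set.mem_singleton_iff] at hx hy hz
    grind
  rw [h1, h2, Set.ncard_singleton, Set.ncard_empty]

theorem edgeClassesOn_triangle {a b c : V} (hab : G.Adj a b) (hbc : G.Adj b c)
    (hca : G.Adj c a) :
    edgeClassesOn G {a, b, c} = {edgeClass hab, edgeClass hbc, edgeClass hca} := by
  ext q
  simp only [Set.mem_insert_iff, Set.mem_singleton_iff]
  constructor
  · rintro ⟨x, y, hxy, rfl | rfl | rfl, rfl | rfl | rfl, rfl⟩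
    · exact absurd rfl hxy.ne
    · exact .inl rfl
    · exact .inr (.inr (edgeClass_comm _))
    · exact .inl (edgeClass_comm _)
    · exact absurd rfl hxy.ne
    · exact .inr (.inl rfl)
    · exact .inr (.inr rfl)
    · exact .inr (.inl (edgeClass_comm _))
    · exact absurd rfl hxy.ne
  · rintro (rfl | rfl | rfl)
    · exact ⟨a, b, hab, by simp, by simp, rfl⟩
    · exact ⟨b, c, hbc, by simp, by simp, rfl⟩
    · exact ⟨c, a, hca, by simp, by simp, rfl⟩

theorem DirectedTriangle.IsSymmetry.reverse {a b c : V} {hab : G.Adj a b} {hbc : G.Adj b c}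
    {hca : G.Adj c a} (h : (directedTriangle hab hbc hca).IsSymmetry) :
    (directedTriangle hca.symm hbc.symm hab.symm).IsSymmetry := by
  obtain ⟨⟨φ, h1, h2⟩, ⟨ψ, h3, h4⟩⟩ := directedTriangle_isSymmetry_iff.1 h
  refine directedTriangle_isSymmetry_iff.2 ⟨⟨ψ.symm, ?_, ?_⟩, ⟨φ.symm, ?_, ?_⟩⟩ <;>
    rw [RelIso.symm_apply_eq] <;> symm <;> assumption

theorem triangleClassesOn_triangle {a b c : V} (hab : G.Adj a b) (hbc : G.Adj b c)
    (hca : G.Adj c a) (h : ¬ (directedTriangle hab hbc hca).IsSymmetry) :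
    triangleClassesOn G {a, b, c} =
      {triangleClass hab hbc hca h,
        triangleClass hca.symm hbc.symm hab.symm fun h' => h h'.reverse} := by
  ext q
  simp only [Set.mem_insert_iff, Set.mem_singleton_iff]
  constructor
  · rintro ⟨x, y, z, hxy, hyz, hzx, hs, hx, hy, hz, rfl⟩
    have := hxy.ne
    have := hyz.ne
    have := hzx.ne
    simp only [triangleClass_eq_iff]
    simp only [Set.mem_insert_iff, Set.mem_singleton_iff] at hx hy hz
    rw [← exists_or]
    -- `x, y, z` permutes `a, b, c`: a rotation gives the first orientation, an odd permutation the
    -- second.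
    refine ⟨RelIso.refl _, ?_⟩
    simp only [RelIso.refl_apply]
    grind
  · rintro (rfl | rfl)
    · exact ⟨a, b, c, hab, hbc, hca, h, by simp, by simp, by simp, rfl⟩
    · exact ⟨a, c, b, hca.symm, hbc.symm, hab.symm, _, by simp, by simp, by simp, rfl⟩

/-- An automorphism carrying edge `ab` to edge `bc` permutes the invariant triangle. Were it to send
`a` to `b` and `b` to `c`, it would be a rotation and make the triangle a symmetry triangle. -/
theorem IsAutInvariant.exists_reflection {a b c : V} (hS : IsAutInvariant G {a, b, c})
    {hab : G.Adj a b} {hbc : G.Adj b c} {hca : G.Adj c a}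
    (h : ¬ (directedTriangle hab hbc hca).IsSymmetry) (he : edgeClass hab = edgeClass hbc) :
    ∃ φ : G ≃g G, φ a = c ∧ φ b = b ∧ φ c = a := by
  obtain ⟨φ, hφ⟩ := edgeClass_eq_iff.1 he
  have hc : φ c ∈ ({a, b, c} : Set V) := hS φ c (by simp)
  simp only [Set.mem_insert_iff, Set.mem_singleton_iff] at hc
  have h1 : φ c ≠ φ a := φ.injective.ne hca.ne
  have h2 : φ c ≠ φ b := φ.injective.ne hbc.ne'
  rcases hφ with ⟨ha, hb⟩ | ⟨ha, hb⟩
  · refine absurd (directedTriangle_isSymmetry_iff.2 ⟨⟨φ, ha, hb⟩, φ, hb, ?_⟩) h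
    grind
  · exact ⟨φ, ha, hb, by grind⟩

/-- The reflection identifies the two orientations, leaving one triangle class, and there are
exactly two edge classes: 2 = 1 + 1. -/
theorem IsAutInvariant.ncard_classesOn_triangle_of_eq {a b c : V}
    (hS : IsAutInvariant G {a, b, c}) {hab : G.Adj a b} {hbc : G.Adj b c} {hca : G.Adj c a}
    (h : ¬ (directedTriangle hab hbc hca).IsSymmetry) (he : edgeClass hab = edgeClass hbc) :
    (edgeClassesOn G {a, b, c}).ncard = (triangleClassesOn G {a, b, c}).ncard + 1 := by
  obtain ⟨φ, ha, hb, hc⟩ := hS.exists_reflection h he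
  have hne : edgeClass hbc ≠ edgeClass hca := by
    intro he'
    have hS' : IsAutInvariant G {b, c, a} := by
      convert hS using 1
      ext x
      simp only [Set.mem_insert_iff, Set.mem_singleton_iff]
      tauto
    obtain ⟨ψ, hb', hc', ha'⟩ :=
      hS'.exists_reflection (directedTriangle_rotate hab hbc hca ▸ h) he'
    refine h (directedTriangle_isSymmetry_iff.2 ?_)
    -- `φ` swaps `a, c` and `ψ` swaps `a, b`; first `ψ`, then `φ`, is the rotation `a → b → c → a`.
    refine ⟨⟨ψ.trans φ, ?_, ?_⟩, ⟨ψ.trans φ, ?_, ?_⟩⟩ <;>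
      simp [RelIso.trans_apply, *]
  have ht : triangleClass hab hbc hca h =
      triangleClass hca.symm hbc.symm hab.symm fun h' => h h'.reverse :=
    triangleClass_eq_iff.2 ⟨φ, .inr (.inl ⟨ha, hb, hc⟩)⟩
  rw [edgeClassesOn_triangle hab hbc hca, triangleClassesOn_triangle hab hbc hca h, ← ht, he,
    Set.pair_eq_singleton, Set.ncard_singleton, Set.insert_eq_of_mem (by simp),
    Set.ncard_pair hne]

/-- The counts are 1 = 0 + 1 for a symmetry triangle, 2 = 1 + 1 when two sides are similar, and 3 =
2 + 1 when none are. -/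
theorem IsAutInvariant.ncard_classesOn_triangle {a b c : V}
    (hS : IsAutInvariant G {a, b, c}) (hab : G.Adj a b) (hbc : G.Adj b c) (hca : G.Adj c a) :
    (edgeClassesOn G {a, b, c}).ncard = (triangleClassesOn G {a, b, c}).ncard + 1 := by
  by_cases h : (directedTriangle hab hbc hca).IsSymmetry
  · have h2 : triangleClassesOn G {a, b, c} = ∅ := by
      refine Set.eq_empty_of_forall_notMem ?_
      rintro q ⟨x, y, z, hxy, hyz, hzx, hs, hx, hy, hz, -⟩
      have : directedTriangle hxy hyz hzx = directedTriangle hab hbc hca ∨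
          directedTriangle hxy hyz hzx = directedTriangle hca.symm hbc.symm hab.symm := by
        have := hxy.ne
        have := hyz.ne
        have := hzx.ne
        simp only [directedTriangle_eq_iff]
        simp only [Set.mem_insert_iff, Set.mem_singleton_iff] at hx hy hz
        grind
      rcases this with h' | h'
      · exact hs (h' ▸ h)
      · exact hs (h' ▸ h.reverse)
    obtain ⟨⟨φ, h3, h4⟩, ⟨ψ, h5, h6⟩⟩ := directedTriangle_isSymmetry_iff.1 h
    have e1 : edgeClass hab = edgeClass hbc := edgeClass_eq_iff.2 ⟨φ, .inl ⟨h3, h4⟩⟩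
    have e2 : edgeClass hbc = edgeClass hca := edgeClass_eq_iff.2 ⟨ψ, .inl ⟨h5, h6⟩⟩
    rw [edgeClassesOn_triangle hab hbc hca, h2, e1, e2]
    simp
  · have hrot : ({a, b, c} : Set V) = {b, c, a} := by
      ext x
      simp only [Set.mem_insert_iff, Set.mem_singleton_iff]
      tauto
    have hrot' : ({a, b, c} : Set V) = {c, a, b} := by
      ext x
      simp only [Set.mem_insert_iff, Set.mem_singleton_iff]
      tauto
    have h' : ¬ (directedTriangle hbc hca hab).IsSymmetry :=
      directedTriangle_rotate hab hbc hca ▸ h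
    by_cases e1 : edgeClass hab = edgeClass hbc
    · exact hS.ncard_classesOn_triangle_of_eq h e1
    by_cases e2 : edgeClass hbc = edgeClass hca
    · rw [hrot] at hS ⊢
      exact hS.ncard_classesOn_triangle_of_eq h' e2
    by_cases e3 : edgeClass hca = edgeClass hab
    · rw [hrot'] at hS ⊢
      exact hS.ncard_classesOn_triangle_of_eq (directedTriangle_rotate hbc hca hab ▸ h') e3
    -- An orientation-reversing automorphism of the triangle would swap two of its sides.
    have ht : triangleClass hab hbc hca h ≠
        triangleClass hca.symm hbc.symm hab.symm fun h' => h h'.reverse := by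
      intro ht
      obtain ⟨φ, ⟨h1, h2, h3⟩ | ⟨h1, h2, h3⟩ | ⟨h1, h2, h3⟩⟩ := triangleClass_eq_iff.1 ht
      · exact e3 (edgeClass_eq_iff.2 ⟨φ, .inr ⟨h3, h1⟩⟩)
      · exact e1 (edgeClass_eq_iff.2 ⟨φ, .inr ⟨h1, h2⟩⟩)
      · exact e2 (edgeClass_eq_iff.2 ⟨φ, .inr ⟨h2, h3⟩⟩)
    rw [edgeClassesOn_triangle hab hbc hca, triangleClassesOn_triangle hab hbc hca h,
      Set.ncard_pair ht, Set.ncard_eq_three]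
    exact ⟨_, _, _, e1, fun h => e3 h.symm, e2, rfl⟩

/-! ### Deleting a layer of degree-two vertices -/

theorem _root_.Set.ncard_range_eq_of_eq_iff {ι α β : Type*} {f : ι → α} {g : ι → β}
    (h : ∀ i j, f i = f j ↔ g i = g j) : (Set.range f).ncard = (Set.range g).ncard := by
  have e : Setoid.ker f = Setoid.ker g := Setoid.ext h
  rw [← Nat.card_coe_set_eq, ← Nat.card_coe_set_eq,
    ← Nat.card_congr (Setoid.quotientKerEquivRange f),
    ← Nat.card_congr (Setoid.quotientKerEquivRange g), e]

/-- The triangles with apex `w` in `D` and base `ab` inside `S` but outside `D`. -/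
structure ApexTriangle (G : SimpleGraph V) (S D : Set V) where
  w : V
  a : V
  b : V
  hw : w ∈ D
  ha : a ∈ S \ D
  hb : b ∈ S \ D
  hwa : G.Adj w a
  hab : G.Adj a b
  hbw : G.Adj b w

theorem ApexTriangle.not_isSymmetry {S D : Set V} (hD : IsAutInvariant G D)
    (t : ApexTriangle G S D) : ¬ (directedTriangle t.hwa t.hab t.hbw).IsSymmetry := by
  intro h
  obtain ⟨⟨φ, h1, -⟩, -⟩ := directedTriangle_isSymmetry_iff.1 h
  exact t.ha.2 (h1 ▸ hD φ _ t.hw)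

/-- The same automorphism witnesses both sides. Invariance of `D` makes it send apex to apex, and by
`hN` the images of `w` and `a` determine that of `b`. -/
theorem ApexTriangle.edgeClass_eq_iff_triangleClass_eq {S D : Set V} (hD : IsAutInvariant G D)
    (hN : ∀ s t : ApexTriangle G S D, s.w = t.w → s.a = t.a → s.b = t.b)
    (hS : IsAutInvariant G S) (s t : ApexTriangle G S D) :
    edgeClass s.hwa = edgeClass t.hwa ↔
      triangleClass s.hwa s.hab s.hbw (s.not_isSymmetry hD) =
        triangleClass t.hwa t.hab t.hbw (t.not_isSymmetry hD) := by
  rw [edgeClass_eq_iff, triangleClass_eq_iff]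
  refine exists_congr fun φ => ?_
  constructor
  · rintro (⟨h1, h2⟩ | ⟨h1, h2⟩)
    · refine .inl ⟨h1, h2, ?_⟩
      exact hN ⟨φ s.w, φ s.a, φ s.b, hD φ _ s.hw, hS.diff hD φ _ s.ha, hS.diff hD φ _ s.hb,
        φ.map_adj_iff.2 s.hwa, φ.map_adj_iff.2 s.hab, φ.map_adj_iff.2 s.hbw⟩ t h1 h2
    · exact absurd (h1 ▸ hD φ _ s.hw) t.ha.2
  · rintro (⟨h1, h2, h3⟩ | ⟨h1, h2, h3⟩ | ⟨h1, h2, h3⟩)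
    · exact .inl ⟨h1, h2⟩
    · exact absurd (h1 ▸ hD φ _ s.hw) t.ha.2
    · exact absurd (h1 ▸ hD φ _ s.hw) t.hb.2

theorem TwoTreeOn.ncard_classesOn_step [Finite V] {S : Set V} (h : TwoTreeOn G S)
    (hS : IsAutInvariant G S)
    (hind : ∀ u v, DegreeTwoOn G S u → DegreeTwoOn G S v → ¬ G.Adj u v)
    (ih : (edgeClassesOn G (S \ {v | DegreeTwoOn G S v})).ncard =
      (triangleClassesOn G (S \ {v | DegreeTwoOn G S v})).ncard + 1) :
    (edgeClassesOn G S).ncard = (triangleClassesOn G S).ncard + 1 := by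
  have hD := hS.degreeTwoOn
  have hDS : ∀ {v}, v ∈ {v | DegreeTwoOn G S v} → v ∈ S := fun hv => hv.1
  have hout : ∀ {u v}, u ∈ {v | DegreeTwoOn G S v} → G.Adj u v →
      v ∉ {v | DegreeTwoOn G S v} := fun hu huv hv => hind _ _ hu hv huv
  have hex : ∀ {w a}, w ∈ {v | DegreeTwoOn G S v} → a ∈ S → G.Adj w a →
      ∃ b ∈ S, G.Adj a b ∧ G.Adj b w := by
    rintro w a ⟨hw, x, y, hxy, hN⟩ ha hwa
    have hx := (hN x).2 (.inl rfl)
    have hy := (hN y).2 (.inr rfl)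
    have hadj := (h.remove hw hxy hN).2
    rcases (hN a).1 ⟨ha, hwa⟩ with rfl | rfl
    · exact ⟨y, hy.1, hadj, hy.2.symm⟩
    · exact ⟨x, hx.1, hadj.symm, hx.2.symm⟩
  have huniq : ∀ s t : ApexTriangle G S {v | DegreeTwoOn G S v},
      s.w = t.w → s.a = t.a → s.b = t.b := by
    intro s t h1 h2
    obtain ⟨-, x, y, hxy, hN⟩ := s.hw
    have := (hN s.a).1 ⟨s.ha.1, s.hwa⟩
    have := (hN s.b).1 ⟨s.hb.1, s.hbw.symm⟩
    have := (hN t.b).1 ⟨t.hb.1, h1 ▸ t.hbw.symm⟩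
    have := s.hab.ne
    have := h2 ▸ t.hab.ne
    grind
  -- From here on `D` matters only through its invariance and the facts `hDS`, `hout`, `hex`,
  -- `huniq`.
  generalize hDdef : {v | DegreeTwoOn G S v} = D at *
  clear hDdef hind h
  let f : ApexTriangle G S D → _ := fun t => edgeClass t.hwa
  let g : ApexTriangle G S D → _ := fun t =>
    triangleClass t.hwa t.hab t.hbw (t.not_isSymmetry hD)
  have hfg : (Set.range f).ncard = (Set.range g).ncard :=
    Set.ncard_range_eq_of_eq_iff (ApexTriangle.edgeClass_eq_iff_triangleClass_eq hD huniq hS)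
  have hE : edgeClassesOn G S = edgeClassesOn G (S \ D) ∪ Set.range f := by
    have key : ∀ {x y} (hxy : G.Adj x y), x ∈ D → y ∈ S → edgeClass hxy ∈ Set.range f := by
      intro x y hxy hx hy
      obtain ⟨z, hz, hyz, hzx⟩ := hex hx hy hxy
      exact ⟨⟨x, y, z, hx, ⟨hy, hout hx hxy⟩, ⟨hz, hout hx hzx.symm⟩, hxy, hyz, hzx⟩, rfl⟩
    ext q
    constructor
    · rintro ⟨x, y, hxy, hx, hy, rfl⟩
      by_cases hxD : x ∈ D
      · exact .inr (key hxy hxD hy)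
      by_cases hyD : y ∈ D
      · exact .inr (edgeClass_comm hxy ▸ key hxy.symm hyD hx)
      · exact .inl ⟨x, y, hxy, ⟨hx, hxD⟩, ⟨hy, hyD⟩, rfl⟩
    · rintro (⟨x, y, hxy, hx, hy, rfl⟩ | ⟨t, rfl⟩)
      · exact ⟨x, y, hxy, hx.1, hy.1, rfl⟩
      · exact ⟨t.w, t.a, t.hwa, hDS t.hw, t.ha.1, rfl⟩
  have hT : triangleClassesOn G S = triangleClassesOn G (S \ D) ∪ Set.range g := by
    have key : ∀ {x y z} (hxy : G.Adj x y) (hyz : G.Adj y z) (hzx : G.Adj z x)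
        (h : ¬ (directedTriangle hxy hyz hzx).IsSymmetry), x ∈ D → y ∈ S → z ∈ S →
        triangleClass hxy hyz hzx h ∈ Set.range g := fun hxy hyz hzx h hx hy hz =>
      ⟨⟨_, _, _, hx, ⟨hy, hout hx hxy⟩, ⟨hz, hout hx hzx.symm⟩, hxy, hyz, hzx⟩, rfl⟩
    ext q
    constructor
    · rintro ⟨x, y, z, hxy, hyz, hzx, hs, hx, hy, hz, rfl⟩
      by_cases hxD : x ∈ D
      · exact .inr (key hxy hyz hzx hs hxD hy hz)
      by_cases hyD : y ∈ D
      · rw [triangleClass_rotate]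
        exact .inr (key _ _ _ _ hyD hz hx)
      by_cases hzD : z ∈ D
      · rw [triangleClass_rotate, triangleClass_rotate]
        exact .inr (key _ _ _ _ hzD hx hy)
      · exact .inl ⟨x, y, z, hxy, hyz, hzx, hs, ⟨hx, hxD⟩, ⟨hy, hyD⟩, ⟨hz, hzD⟩, rfl⟩
    · rintro (⟨x, y, z, hxy, hyz, hzx, hs, hx, hy, hz, rfl⟩ | ⟨t, rfl⟩)
      · exact ⟨x, y, z, hxy, hyz, hzx, hs, hx.1, hy.1, hz.1, rfl⟩
      · exact ⟨t.w, t.a, t.b, t.hwa, t.hab, t.hbw, _, hDS t.hw, t.ha.1, t.hb.1, rfl⟩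
  -- An apex in `D` cannot be carried into `S \ D`, so no class is counted both before and after the
  -- deletion.
  have hEd : Disjoint (edgeClassesOn G (S \ D)) (Set.range f) := by
    rw [Set.disjoint_left]
    rintro q ⟨x, y, hxy, hx, hy, rfl⟩ ⟨t, ht⟩
    obtain ⟨φ, ⟨h1, -⟩ | ⟨h1, -⟩⟩ := edgeClass_eq_iff.1 ht
    · exact hx.2 (h1 ▸ hD φ _ t.hw)
    · exact hy.2 (h1 ▸ hD φ _ t.hw)
  have hTd : Disjoint (triangleClassesOn G (S \ D)) (Set.range g) := by
    rw [Set.disjoint_left]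
    rintro q ⟨x, y, z, hxy, hyz, hzx, hs, hx, hy, hz, rfl⟩ ⟨t, ht⟩
    obtain ⟨φ, ⟨h1, -⟩ | ⟨h1, -⟩ | ⟨h1, -⟩⟩ := triangleClass_eq_iff.1 ht
    · exact hx.2 (h1 ▸ hD φ _ t.hw)
    · exact hy.2 (h1 ▸ hD φ _ t.hw)
    · exact hz.2 (h1 ▸ hD φ _ t.hw)
  rw [hE, hT, Set.ncard_union_eq hEd, Set.ncard_union_eq hTd, ih, hfg]
  ring

/-! ### The induction on the size of the invariant set -/

theorem TwoTreeOn.ncard_edgeClassesOn [Finite V] {S : Set V} (h : TwoTreeOn G S)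
    (hS : IsAutInvariant G S) :
    (edgeClassesOn G S).ncard = (triangleClassesOn G S).ncard + 1 := by
  induction hn : S.ncard using Nat.strong_induction_on generalizing S with
  | _ n ih =>
    rcases h.eq_pair_or_exists_degreeTwoOn with ⟨a, b, hab, rfl⟩ | ⟨v, hv⟩
    · exact ncard_classesOn_pair hab
    by_cases hind : ∀ u v, DegreeTwoOn G S u → DegreeTwoOn G S v → ¬ G.Adj u v
    · refine h.ncard_classesOn_step hS hind (ih _ ?_ (h.diff_degreeTwoOn hind)
        (hS.diff hS.degreeTwoOn) rfl)
      rw [← hn]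
      exact Set.ncard_lt_ncard ⟨Set.sdiff_subset, fun h => (h hv.1).2 hv⟩
    · push Not at hind
      obtain ⟨u, v, hu, hv, huv⟩ := hind
      obtain ⟨x, hvx, hxu, rfl⟩ := h.eq_triangle_of_adj_degreeTwoOn hu hv huv
      exact hS.ncard_classesOn_triangle huv hvx hxu

end SimpleGraph

theorem mainTheorem5 {V : Type*} (G : SimpleGraph V) (hG : IsKTree 2 G) :
    Nat.card (Quotient G.edgeSimilarity) =
      Nat.card (Quotient G.nonsymmetryTriangleSimilarity) + 1 := by
  have h := hG.twoTreeOn_univ rfl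
  have : Finite V := Set.finite_univ_iff.1 h.finite
  have := h.ncard_edgeClassesOn fun _ _ _ => trivial
  rwa [SimpleGraph.edgeClassesOn_univ, SimpleGraph.triangleClassesOn_univ, Set.ncard_univ,
    Set.ncard_univ] at this
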